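/- Let $D$ be an integrally closed domain. For a nonzero fractional ideal $A$ of an integral domain $R$ with quotient field $F$, put $A^{-1}=\{x\in F : xA\subseteq R\}$, $A_v=(A^{-1})^{-1}$, and let $A_t$ be the union of the $J_v$ over all nonzero finitely generated fractional ideals $J\subseteq A$; $A$ is called $t$-invertible if $(AA^{-1})_t=R$. The domain $R$ is a Prüfer $v$-multiplication domain (PVMD) if every nonzero finitely generated ideal of $R$ is $t$-invertible. A prime upper to zero ideal of $D[X]$ is a nonzero prime ideal $P$ of $D[X]$ with $P\cap D=(0)$. Then the following conditions are equivalent. (a) $D$ is a PVMD. (b) Every polynomial $f\in D[X]$ of degree one is contained in a $t$-invertible prime upper to zero ideal of $D[X]$. (c) Every ideal $A$ of $D[X]$ with $A\cap D=(0)$ is contained in a $t$-invertible prime upper to zero ideal of $D[X]$. -/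

import Mathlib

open scoped nonZeroDivisors Polynomial

namespace TIdeal

section Operations

variable {R : Type*} [CommRing R] [IsDomain R] {K : Type*} [Field K] [Algebra R K]
  [IsFractionRing R K]

/-- The `v`-operation `A ↦ A_v = (A⁻¹)⁻¹` on the fractional ideals of an integral domain `R` with
quotient field `K`. For `A ≠ 0`, Mathlib's `A⁻¹ = 1 / A` is `(R :_K A) = {x ∈ K | x A ⊆ R}`
(and it is `0` for `A = 0`, so that `0_v = 0`). -/
noncomputable def vOp (A : FractionalIdeal R⁰ K) : FractionalIdeal R⁰ K := (A⁻¹)⁻¹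

theorem inv_ne_zero_of_ne_zero {A : FractionalIdeal R⁰ K} (hA : A ≠ 0) : A⁻¹ ≠ 0 := by
  obtain ⟨d, hd, h⟩ := A.isFractional
  intro h0
  have hd0 : algebraMap R K d ≠ 0 := by
    simpa using nonZeroDivisors.ne_zero hd
  have hmem : algebraMap R K d ∈ A⁻¹ := by
    rw [FractionalIdeal.mem_inv_iff hA]
    intro y hy
    obtain ⟨r, hr⟩ := h y hy
    rw [FractionalIdeal.mem_one_iff]
    exact ⟨r, by rw [hr, Algebra.smul_def]⟩
  rw [h0, FractionalIdeal.mem_zero_iff] at hmem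
  exact hd0 hmem

theorem vOp_mono {A B : FractionalIdeal R⁰ K} (h : A ≤ B) : vOp A ≤ vOp B := by
  by_cases hA : A = 0
  · subst hA
    have h0 : vOp (0 : FractionalIdeal R⁰ K) = 0 := by
      rw [vOp, FractionalIdeal.inv_zero', FractionalIdeal.inv_zero']
    rw [h0]
    exact FractionalIdeal.zero_le _
  · have hB : B ≠ 0 := by
      rintro rfl
      exact hA (le_antisymm h (FractionalIdeal.zero_le A))
    exact FractionalIdeal.inv_anti_mono (inv_ne_zero_of_ne_zero hB) (inv_ne_zero_of_ne_zero hA)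
      (FractionalIdeal.inv_anti_mono hA hB h)

/-- The `t`-operation: `A_t` is the union of the `J_v`, where `J` ranges over the finitely generated
fractional ideals contained in `A`. (As `0_v = 0`, admitting `J = 0` changes nothing for
`A ≠ 0`.) -/
noncomputable def tOp (A : FractionalIdeal R⁰ K) : FractionalIdeal R⁰ K :=
  ⟨{ carrier := {x : K | ∃ J : FractionalIdeal R⁰ K,
        (J : Submodule R K).FG ∧ J ≤ A ∧ x ∈ vOp J}
     zero_mem' := ⟨0, by simpa using Submodule.fg_bot, FractionalIdeal.zero_le A,
        (vOp (0 : FractionalIdeal R⁰ K)).val.zero_mem⟩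
     add_mem' := by
       rintro x y ⟨I, hI, hIA, hx⟩ ⟨J, hJ, hJA, hy⟩
       refine ⟨I ⊔ J, ?_, sup_le hIA hJA, ?_⟩
       · rw [FractionalIdeal.coe_sup]
         exact hI.sup hJ
       · exact (vOp (I ⊔ J)).val.add_mem (vOp_mono le_sup_left hx) (vOp_mono le_sup_right hy)
     smul_mem' := by
       rintro r x ⟨J, hJ, hJA, hx⟩
       exact ⟨J, hJ, hJA, (vOp J).val.smul_mem r hx⟩ },
   by
     obtain ⟨d, hd, h⟩ := (vOp A).isFractional
     refine ⟨d, hd, ?_⟩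
     rintro x ⟨J, -, hJA, hx⟩
     exact h x (vOp_mono hJA hx)⟩

/-- A nonzero fractional ideal `A` is `t`-invertible if `(A A⁻¹)_t = R`. -/
def IsTInvertible (A : FractionalIdeal R⁰ K) : Prop :=
  A ≠ 0 ∧ tOp (A * A⁻¹) = 1

end Operations

/-- A (nonzero) ideal of the domain `R` is `t`-invertible if it is so as a fractional ideal. -/
def IsTInvertibleIdeal {R : Type*} [CommRing R] [IsDomain R] (I : Ideal R) : Prop :=
  IsTInvertible (I : FractionalIdeal R⁰ (FractionRing R))

/-- A Prüfer `v`-multiplication domain: an integral domain all of whose nonzero finitely generated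
ideals are `t`-invertible. -/
def IsPVMD (D : Type*) [CommRing D] [IsDomain D] : Prop :=
  ∀ I : Ideal D, I ≠ ⊥ → I.FG → IsTInvertibleIdeal I

/-- A prime upper to zero of `D`: a nonzero prime ideal `P` of `D[X]` with `P ∩ D = (0)`. -/
structure IsPrimeUpperToZero {D : Type*} [CommRing D] (P : Ideal D[X]) : Prop where
  isPrime : P.IsPrime
  ne_bot : P ≠ ⊥
  comap_C_eq_bot : P.comap (Polynomial.C : D →+* D[X]) = ⊥

end TIdeal

/-! Let `K` be the quotient field of `D`. A prime upper to zero `P` equals `f K[X] ∩ D[X]` for any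
nonzero `f ∈ P` of least degree. Since `D` is an intersection of valuation rings, Gauss's lemma over
each of them gives: if `f h ∈ D[X]` with `h ∈ K[X]`, every coefficient of `h` lies in `c(f)⁻¹`,
where `c(f)` is the content ideal. So `P` consists of the `f h` with `h` having coefficients in
`c(f)⁻¹`, and `P` is `t`-invertible iff `c(f)` is (`isTInvertible_of_contentIdeal`,
`isTInvertible_contentIdeal`).

In a PVMD the finitely generated `c(f)` is `t`-invertible, which gives (c), and (b) is a special
case. Under (b), `a X + b` with `a ≠ 0` has least degree in the prime containing it, so its content
`(a, b)` is `t`-invertible; Prüfer's ideal identity passes from two generators to finitely many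
(`isPVMD_of_span_pair`). -/

open Polynomial

/-! ### Gauss's lemma over integrally closed domains -/

namespace Polynomial

/-- Multiplicativity of the content over a valuation ring. -/
theorem coeff_mul_coeff_mem_valuationSubring {K : Type*} [Field K] (V : ValuationSubring K)
    {f g : K[X]} (h : ∀ n, (f * g).coeff n ∈ V) (i j : ℕ) : f.coeff i * g.coeff j ∈ V := by
  rcases eq_or_ne g 0 with rfl | hg
  · simp
  -- Dividing `g` by a coefficient of largest valuation makes it a primitive polynomial over `V`, to
  -- which Gauss's lemma applies.
  obtain ⟨m, hm, hmax⟩ := g.support.exists_max_image (fun n => V.valuation (g.coeff n))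
    (nonempty_support_iff.2 hg)
  have hb : g.coeff m ≠ 0 := mem_support_iff.1 hm
  set b := g.coeff m
  have hle : ∀ n, g.coeff n / b ∈ V := fun n => by
    rw [← V.valuation_le_one_iff, map_div₀]
    by_cases hn : n ∈ g.support
    · exact div_le_one_of_le₀ (hmax n hn) zero_le
    · simp [notMem_support_iff.1 hn]
  obtain ⟨g', hg'⟩ : C b⁻¹ * g ∈ lifts (algebraMap V K) := by
    rw [lifts_iff_coeff_lifts]
    intro n
    exact ⟨⟨_, hle n⟩, by simp [div_eq_inv_mul]⟩
  have hg'' : g'.map (algebraMap V K) = C b⁻¹ * g := hg'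
  have hprim : g'.IsPrimitive := by
    intro r hr
    have h1 : g'.coeff m = 1 := by
      apply IsFractionRing.injective V K
      rw [← coeff_map, hg'', coeff_C_mul, map_one]
      exact inv_mul_cancel₀ hb
    exact isUnit_of_dvd_one (h1 ▸ (C_dvd_iff_dvd_coeff r g').1 hr m)
  have hf : C b * f ∈ lifts (algebraMap V K) := by
    rw [← hprim.mul_map_mem_lifts_iff, hg'', lifts_iff_coeff_lifts]
    intro n
    refine ⟨⟨_, h n⟩, ?_⟩
    have : C b * f * (C b⁻¹ * g) = f * g := by
      rw [show C b * f * (C b⁻¹ * g) = C b * C b⁻¹ * (f * g) by ring, ← C_mul,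
        mul_inv_cancel₀ hb, C_1, one_mul]
    rw [this]
    rfl
  obtain ⟨v, hv⟩ := (lifts_iff_coeff_lifts _).1 hf i
  have hv' : b * f.coeff i ∈ V := by
    rw [← coeff_C_mul, ← hv]
    exact v.2
  have := V.mul_mem _ _ hv' (hle j)
  rwa [show b * f.coeff i * (g.coeff j / b) = f.coeff i * g.coeff j by field_simp] at this

variable {D : Type*} [CommRing D] [IsDomain D] [IsIntegrallyClosed D]
  {K : Type*} [Field K] [Algebra D K] [IsFractionRing D K]

-- An element of `K` outside the integrally closed ring `D` is missed by some valuation ring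
-- containing `D`, so the valuation ring case suffices.
omit [IsDomain D] in
theorem coeff_mul_coeff_mem_range {f g : K[X]}
    (h : ∀ n, (f * g).coeff n ∈ (algebraMap D K).range) (i j : ℕ) :
    f.coeff i * g.coeff j ∈ (algebraMap D K).range := by
  have : IsIntegrallyClosedIn (algebraMap D K).range K := by
    rw [Subring.isIntegrallyClosedIn_iff]
    intro x hx
    have : IsIntegral D x := by
      obtain ⟨p, hp, hpx⟩ := hx
      obtain ⟨q, hq, hdeg, hqm⟩ := lifts_and_natDegree_eq_and_monic
        (f := (algebraMap D K).rangeRestrict)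
        (mem_lifts_of_surjective (algebraMap D K).rangeRestrict_surjective p) hp
      refine ⟨q, hqm, ?_⟩
      rw [← hq, eval₂_map] at hpx
      exact hpx
    obtain ⟨y, hy⟩ := IsIntegrallyClosed.isIntegral_iff.1 this
    exact ⟨y, hy⟩
  by_contra hx
  obtain ⟨V, hV, hxV⟩ := Subring.exists_le_valuationSubring_of_isIntegrallyClosedIn hx
  exact hxV (coeff_mul_coeff_mem_valuationSubring V (fun n => hV (h n)) i j)

end Polynomial

namespace TIdeal

/-! ### A finite criterion for `t`-invertibility -/

section Criterion

variable {R : Type*} [CommRing R] [IsDomain R] {K : Type*} [Field K] [Algebra R K]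
  [IsFractionRing R K]

theorem mul_inv_le_one (A : FractionalIdeal R⁰ K) : A * A⁻¹ ≤ 1 :=
  FractionalIdeal.mul_one_div_le_one

omit [IsDomain R] [IsFractionRing R K] in
theorem exists_mem_ne_zero {A : FractionalIdeal R⁰ K} (hA : A ≠ 0) : ∃ x ∈ A, x ≠ 0 := by
  by_contra! h
  exact hA (FractionalIdeal.eq_zero_iff.2 h)

omit [IsDomain R] [IsFractionRing R K] in
theorem mul_ne_zero_of_ne_zero {A B : FractionalIdeal R⁰ K} (hA : A ≠ 0) (hB : B ≠ 0) :
    A * B ≠ 0 := by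
  obtain ⟨x, hx, hx0⟩ := exists_mem_ne_zero hA
  obtain ⟨y, hy, hy0⟩ := exists_mem_ne_zero hB
  intro h
  have := FractionalIdeal.mul_mem_mul hx hy
  rw [h, FractionalIdeal.mem_zero_iff] at this
  exact mul_ne_zero hx0 hy0 this

theorem mem_one_of_forall_mem_span {s : Set K} {x y : K}
    (h : ∀ z ∈ s, x * z ∈ (1 : FractionalIdeal R⁰ K)) (hy : y ∈ Submodule.span R s) :
    x * y ∈ (1 : FractionalIdeal R⁰ K) := by
  induction hy using Submodule.span_induction with
  | mem z hz => exact h z hz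
  | zero => simp
  | add a b _ _ ha hb => rw [mul_add]; exact (1 : FractionalIdeal R⁰ K).val.add_mem ha hb
  | smul r a _ ha =>
    rw [mul_smul_comm]; exact (1 : FractionalIdeal R⁰ K).val.smul_mem r ha

/-- A `t`-invertible fractional ideal `A` admits a finite subset `s` of `A A⁻¹` with
`s⁻¹ ⊆ R`. -/
theorem IsTInvertible.exists_finset {A : FractionalIdeal R⁰ K} (hA : IsTInvertible A) :
    ∃ s : Finset K, (∃ z ∈ s, z ≠ 0) ∧ (∀ z ∈ s, z ∈ A * A⁻¹) ∧
      ∀ x : K, (∀ z ∈ s, x * z ∈ (1 : FractionalIdeal R⁰ K)) →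
        x ∈ (1 : FractionalIdeal R⁰ K) := by
  obtain ⟨J, ⟨s, hs⟩, hJA, h1⟩ : (1 : K) ∈ tOp (A * A⁻¹) := by
    rw [hA.2]
    exact FractionalIdeal.one_mem_one _
  have hJ : J ≠ 0 := by
    rintro rfl
    rw [vOp, FractionalIdeal.inv_zero', FractionalIdeal.inv_zero',
      FractionalIdeal.mem_zero_iff] at h1
    exact one_ne_zero h1
  refine ⟨s, ?_, fun z hz => hJA ?_, fun x hx => ?_⟩
  · by_contra! h
    apply hJ
    rw [← FractionalIdeal.coeToSubmodule_inj, ← hs, FractionalIdeal.coe_zero,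
      Submodule.span_eq_bot]
    exact h
  · change z ∈ (J : Submodule R K)
    rw [← hs]
    exact Submodule.subset_span hz
  · have hxJ : x ∈ J⁻¹ := by
      rw [FractionalIdeal.mem_inv_iff hJ]
      intro y hy
      refine mem_one_of_forall_mem_span hx ?_
      rw [hs]
      exact hy
    have := (FractionalIdeal.mem_inv_iff (inv_ne_zero_of_ne_zero hJ)).1 h1 x hxJ
    rwa [one_mul] at this

/-- Converse of `IsTInvertible.exists_finset`. Any `B` with `A B ⊆ R` may replace `A⁻¹`, since it
lies inside it. -/
theorem isTInvertible_of_finset {A : FractionalIdeal R⁰ K} (hA : A ≠ 0)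
    (B : FractionalIdeal R⁰ K) (hB : A * B ≤ 1) (s : Finset K) (hs : ∀ z ∈ s, z ∈ A * B)
    (h : ∀ x : K, (∀ z ∈ s, x * z ∈ (1 : FractionalIdeal R⁰ K)) →
      x ∈ (1 : FractionalIdeal R⁰ K)) : IsTInvertible A := by
  classical
  have hBA : B ≤ A⁻¹ := by
    intro b hb
    rw [FractionalIdeal.mem_inv_iff hA]
    intro y hy
    rw [mul_comm]
    exact hB (FractionalIdeal.mul_mem_mul hy hb)
  have hAB : A * B ≤ A * A⁻¹ := mul_le_mul_right hBA A
  obtain ⟨w, hw, hw0⟩ :=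
    exists_mem_ne_zero (mul_ne_zero_of_ne_zero hA (inv_ne_zero_of_ne_zero hA))
  -- The extra nonzero generator `w` ensures `J ≠ 0`, as Mathlib's inverse of `0` is `0`.
  set J := FractionalIdeal.spanFinset R (insert w s) (id : K → K) with hJdef
  have hmem : ∀ z ∈ insert w s, z ∈ J := fun z hz => by
    change z ∈ Submodule.span R (id '' ((insert w s : Finset K) : Set K))
    exact Submodule.subset_span ⟨z, hz, rfl⟩
  have hJ : J ≠ 0 :=
    FractionalIdeal.spanFinset_ne_zero.2 ⟨w, Finset.mem_insert_self _ _, hw0⟩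
  have hJA : J ≤ A * A⁻¹ := by
    change Submodule.span R (id '' ((insert w s : Finset K) : Set K)) ≤
      ((A * A⁻¹ : FractionalIdeal R⁰ K) : Submodule R K)
    rw [Submodule.span_le]
    rintro _ ⟨z, hz, rfl⟩
    rcases Finset.mem_insert.1 hz with rfl | hz
    · exact hw
    · exact hAB (hs z hz)
  refine ⟨hA, le_antisymm ?_ ?_⟩
  · rintro x ⟨I, -, hI, hx⟩
    have := vOp_mono (hI.trans (mul_inv_le_one A)) hx
    rwa [vOp, FractionalIdeal.inv_eq, FractionalIdeal.inv_eq, FractionalIdeal.div_one,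
      FractionalIdeal.div_one] at this
  · have h1 : (1 : K) ∈ tOp (A * A⁻¹) := by
      refine ⟨J, ?_, hJA, ?_⟩
      · rw [hJdef, FractionalIdeal.spanFinset_coe]
        exact Submodule.fg_span ((Finset.finite_toSet _).image _)
      · rw [vOp, FractionalIdeal.mem_inv_iff (inv_ne_zero_of_ne_zero hJ)]
        intro y hy
        rw [one_mul]
        refine h y fun z hz => ?_
        exact (FractionalIdeal.mem_inv_iff hJ).1 hy z (hmem z (Finset.mem_insert_of_mem hz))
    exact FractionalIdeal.one_le.2 h1

theorem IsTInvertible.of_mul_left {A B : FractionalIdeal R⁰ K} (h : IsTInvertible (A * B)) :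
    IsTInvertible A := by
  obtain ⟨s, -, hs, hx⟩ := h.exists_finset
  have hA : A ≠ 0 := by
    rintro rfl
    exact h.1 (zero_mul B)
  rw [mul_assoc] at hs
  refine isTInvertible_of_finset hA (B * (A * B)⁻¹) ?_ s hs hx
  rw [← mul_assoc]
  exact mul_inv_le_one _

theorem IsTInvertible.mul {A B : FractionalIdeal R⁰ K} (hA : IsTInvertible A)
    (hB : IsTInvertible B) : IsTInvertible (A * B) := by
  classical
  obtain ⟨s, -, hs, hsx⟩ := hA.exists_finset
  obtain ⟨t, -, ht, htx⟩ := hB.exists_finset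
  have hcomm : A * B * (A⁻¹ * B⁻¹) = A * A⁻¹ * (B * B⁻¹) := by ring
  refine isTInvertible_of_finset (mul_ne_zero_of_ne_zero hA.1 hB.1) (A⁻¹ * B⁻¹) ?_
    (Finset.image₂ (· * ·) s t) ?_ ?_
  · rw [hcomm]
    exact mul_le_one' (mul_inv_le_one A) (mul_inv_le_one B)
  · intro z hz
    obtain ⟨a, ha, b, hb, rfl⟩ := Finset.mem_image₂.1 hz
    rw [hcomm]
    exact FractionalIdeal.mul_mem_mul (hs a ha) (ht b hb)
  · intro x hx
    refine hsx x fun a ha => htx _ fun b hb => ?_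
    rw [mul_assoc]
    exact hx _ (Finset.mem_image₂_of_mem ha hb)

theorem isTInvertible_spanSingleton {a : K} (ha : a ≠ 0) :
    IsTInvertible (FractionalIdeal.spanSingleton R⁰ a) := by
  refine isTInvertible_of_finset (FractionalIdeal.spanSingleton_ne_zero_iff.2 ha)
    (FractionalIdeal.spanSingleton R⁰ a⁻¹)
    ?_ {1} ?_ ?_
  · rw [FractionalIdeal.spanSingleton_mul_spanSingleton, mul_inv_cancel₀ ha,
      FractionalIdeal.spanSingleton_one]
  · simp [FractionalIdeal.spanSingleton_mul_spanSingleton, mul_inv_cancel₀ ha]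
  · simp

end Criterion

/-! ### Reduction to ideals with two generators -/

section FinitelyGenerated

variable {D : Type*} [CommRing D] [IsDomain D]

theorem isTInvertibleIdeal_span_singleton {a : D} (ha : a ≠ 0) :
    IsTInvertibleIdeal (Ideal.span {a}) := by
  rw [IsTInvertibleIdeal, FractionalIdeal.coeIdeal_span_singleton]
  exact isTInvertible_spanSingleton (by simpa using ha)

theorem IsTInvertibleIdeal.mul {I J : Ideal D} (hI : IsTInvertibleIdeal I)
    (hJ : IsTInvertibleIdeal J) : IsTInvertibleIdeal (I * J) := by
  rw [IsTInvertibleIdeal, FractionalIdeal.coeIdeal_mul]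
  exact IsTInvertible.mul hI hJ

theorem IsTInvertibleIdeal.of_mul_left {I J : Ideal D} (h : IsTInvertibleIdeal (I * J)) :
    IsTInvertibleIdeal I := by
  rw [IsTInvertibleIdeal, FractionalIdeal.coeIdeal_mul] at h
  exact IsTInvertible.of_mul_left h

-- Prüfer's identity: it makes `A + B + C` a factor of a product of ideals that each omit one
-- summand.
omit [IsDomain D] in
theorem add_mul_add_mul_add (A B C : Ideal D) :
    (A + B) * (B + C) * (C + A) = (A + B + C) * (A * B + B * C + C * A) := by
  -- The left side expands to two copies of `A B C`, the right side to three; ideal addition is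
  -- idempotent.
  have h : A * B * C + A * B * C = A * B * C := sup_idem _
  calc (A + B) * (B + C) * (C + A)
      = A * A * B + A * A * C + A * B * B + B * B * C + A * C * C + B * C * C
        + (A * B * C + A * B * C) := by ring
    _ = A * A * B + A * A * C + A * B * B + B * B * C + A * C * C + B * C * C
        + (A * B * C + A * B * C + A * B * C) := by rw [h, h]
    _ = (A + B + C) * (A * B + B * C + C * A) := by ring

/-- It suffices to test the PVMD property on the ideals with two generators. -/
theorem isPVMD_of_span_pair
    (h : ∀ a b : D, a ≠ 0 → IsTInvertibleIdeal (Ideal.span {a, b})) : IsPVMD D := by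
  classical
  suffices H : ∀ n : ℕ, ∀ s : Finset D, s.card ≤ n → Ideal.span (s : Set D) ≠ ⊥ →
      IsTInvertibleIdeal (Ideal.span (s : Set D)) by
    rintro I hI ⟨s, rfl⟩
    exact H _ s le_rfl hI
  intro n
  induction n with
  | zero =>
    intro s hs h0
    rw [Nat.le_zero, Finset.card_eq_zero] at hs
    simp [hs] at h0
  | succ n ih =>
    intro s hs h0
    obtain ⟨a, ha, ha0⟩ : ∃ a ∈ s, a ≠ 0 := by
      by_contra! hc
      exact h0 (Ideal.span_eq_bot.2 hc)
    obtain ⟨s, has, rfl⟩ : ∃ t, a ∉ t ∧ insert a t = s :=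
      ⟨s.erase a, Finset.notMem_erase a s, Finset.insert_erase ha⟩
    rw [Finset.card_insert_of_notMem has] at hs
    -- With two nonzero generators `a`, `b` split off, all three factors in Prüfer's identity are
    -- nonzero and fall under the hypothesis on pairs or the induction hypothesis.
    by_cases hb : ∃ b ∈ s, b ≠ 0
    · obtain ⟨b, hb, hb0⟩ := hb
      obtain ⟨s, hbs, rfl⟩ : ∃ t, b ∉ t ∧ insert b t = s :=
        ⟨s.erase b, Finset.notMem_erase b s, Finset.insert_erase hb⟩
      rw [Finset.card_insert_of_notMem hbs] at hs
      have e : Ideal.span ((insert a (insert b s) : Finset D) : Set D) =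
          Ideal.span {a} + Ideal.span {b} + Ideal.span (s : Set D) := by
        simp [Ideal.span_insert, sup_assoc]
      have hins : ∀ c : D, c ≠ 0 →
          IsTInvertibleIdeal (Ideal.span {c} + Ideal.span (s : Set D)) := by
        intro c hc
        have e' : Ideal.span {c} + Ideal.span (s : Set D) =
            Ideal.span ((insert c s : Finset D) : Set D) := by
          simp [Ideal.span_insert]
        rw [e']
        refine ih _ ((Finset.card_insert_le _ _).trans (by omega)) fun hbot => hc ?_
        exact Ideal.span_eq_bot.1 hbot c (by simp)
      rw [e]
      refine IsTInvertibleIdeal.of_mul_left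
        (J := Ideal.span {a} * Ideal.span {b} + Ideal.span {b} * Ideal.span (s : Set D)
          + Ideal.span (s : Set D) * Ideal.span {a}) ?_
      rw [← add_mul_add_mul_add]
      refine (IsTInvertibleIdeal.mul ?_ (hins b hb0)).mul ?_
      · have := h a b ha0
        rwa [Ideal.span_insert] at this
      · rw [add_comm]
        exact hins a ha0
    · push Not at hb
      have hs0 : Ideal.span (s : Set D) = ⊥ := Ideal.span_eq_bot.2 hb
      rw [Finset.coe_insert, Ideal.span_insert, hs0, sup_bot_eq]
      exact isTInvertibleIdeal_span_singleton ha0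

end FinitelyGenerated

/-! ### Embedding `K[X]` in the quotient field of `D[X]` -/

section FractionField

variable (D : Type*) [CommRing D] [IsDomain D] (K : Type*) [Field K] [Algebra D K]
  [IsFractionRing D K] (L : Type*) [Field L] [Algebra D[X] L] [IsFractionRing D[X] L]

omit [IsDomain D] in
theorem algebraMap_comp_C_injective :
    Function.Injective ((algebraMap D[X] L).comp (C : D →+* D[X])) :=
  (IsFractionRing.injective D[X] L).comp C_injective

/-- The embedding of `K[X]` into the quotient field of `D[X]`, for `K` the quotient field of
`D`. -/
noncomputable def fractionEmbedding : K[X] →+* L :=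
  eval₂RingHom (IsFractionRing.lift (K := K) (algebraMap_comp_C_injective D L))
    (algebraMap D[X] L X)

variable {D}

omit [IsDomain D] in
theorem fractionEmbedding_map (p : D[X]) :
    fractionEmbedding D K L (p.map (algebraMap D K)) = algebraMap D[X] L p := by
  have : (fractionEmbedding D K L).comp (mapRingHom (algebraMap D K)) = algebraMap D[X] L := by
    ext x
    · simp [fractionEmbedding]
    · simp [fractionEmbedding]
  exact DFunLike.congr_fun this p

theorem exists_C_mul_eq_map (h : K[X]) :
    ∃ c : D, c ≠ 0 ∧ ∃ p : D[X], C (algebraMap D K c) * h = p.map (algebraMap D K) := by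
  obtain ⟨c, hc, hp⟩ := IsLocalization.integerNormalization_spec D⁰ h
  refine ⟨c, nonZeroDivisors.ne_zero hc, IsLocalization.integerNormalization D⁰ h, ?_⟩
  rw [hp, ← algebraMap_smul K c h, smul_eq_C_mul]

omit [IsDomain D] in
variable (D) in
theorem map_algebraMap_injective : Function.Injective (map (algebraMap D K)) :=
  map_injective _ (IsFractionRing.injective D K)

variable (D) in
theorem fractionEmbedding_injective : Function.Injective (fractionEmbedding D K L) := by
  rw [injective_iff_map_eq_zero]
  intro h hh
  obtain ⟨c, hc, p, hp⟩ := exists_C_mul_eq_map (D := D) K h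
  have h0 : algebraMap D[X] L p = 0 := by
    rw [← fractionEmbedding_map K, ← hp, map_mul, hh, mul_zero]
  rw [(injective_iff_map_eq_zero _).1 (IsFractionRing.injective D[X] L) p h0,
    Polynomial.map_zero, mul_eq_zero, C_eq_zero] at hp
  exact hp.resolve_left (by simpa using hc)

omit [IsDomain D] [IsFractionRing D K] in
theorem mem_one_iff_mem_range {x : K} :
    x ∈ (1 : FractionalIdeal D⁰ K) ↔ x ∈ (algebraMap D K).range := by
  rw [FractionalIdeal.mem_one_iff]; rfl

variable {K}

omit [IsDomain D] [IsFractionRing D K] in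
theorem exists_map_eq_iff {h : K[X]} :
    (∃ p : D[X], p.map (algebraMap D K) = h) ↔
      ∀ n, h.coeff n ∈ (1 : FractionalIdeal D⁰ K) := by
  rw [← mem_lifts, lifts_iff_coeff_lifts]
  simp only [FractionalIdeal.mem_one_iff, Set.mem_range]

theorem fractionEmbedding_mem_one_iff {h : K[X]} :
    fractionEmbedding D K L h ∈ (1 : FractionalIdeal D[X]⁰ L) ↔
      ∀ n, h.coeff n ∈ (1 : FractionalIdeal D⁰ K) := by
  rw [← exists_map_eq_iff, FractionalIdeal.mem_one_iff]
  refine exists_congr fun p => ?_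
  rw [← fractionEmbedding_map K, (fractionEmbedding_injective D K L).eq_iff]

theorem fractionEmbedding_C_mem_one_iff {x : K} :
    fractionEmbedding D K L (C x) ∈ (1 : FractionalIdeal D[X]⁰ L) ↔
      x ∈ (1 : FractionalIdeal D⁰ K) := by
  rw [fractionEmbedding_mem_one_iff]
  refine ⟨fun h => by simpa using h 0, fun h n => ?_⟩
  rw [coeff_C]
  split_ifs
  · exact h
  · exact (1 : FractionalIdeal D⁰ K).zero_mem

end FractionField

/-! ### `t`-invertibility of `P` versus that of the content -/

section Content

variable {D : Type*} [CommRing D] [IsDomain D] [IsIntegrallyClosed D]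
  {K : Type*} [Field K] [Algebra D K] [IsFractionRing D K]
  {L : Type*} [Field L] [Algebra D[X] L] [IsFractionRing D[X] L]
  {f : D[X]} {P : Ideal D[X]}

omit [IsIntegrallyClosed D] in
theorem mul_mem_one_of_mem_contentIdeal {x a : K}
    (h : ∀ n, x * algebraMap D K (f.coeff n) ∈ (1 : FractionalIdeal D⁰ K))
    (ha : a ∈ (f.contentIdeal : FractionalIdeal D⁰ K)) :
    x * a ∈ (1 : FractionalIdeal D⁰ K) := by
  refine mem_one_of_forall_mem_span (s := Set.range fun n => algebraMap D K (f.coeff n)) ?_ ?_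
  · rintro _ ⟨n, rfl⟩
    exact h n
  · obtain ⟨b, hb, rfl⟩ := (FractionalIdeal.mem_coeIdeal D⁰).1 ha
    have hb' : b ∈ Submodule.span D (f.coeffs : Set D) := hb
    have := Submodule.mem_map_of_mem (f := Algebra.linearMap D K) hb'
    rw [Submodule.map_span] at this
    refine Submodule.span_mono ?_ this
    rintro _ ⟨c, hc, rfl⟩
    obtain ⟨n, -, rfl⟩ := mem_coeffs_iff.1 hc
    exact ⟨n, rfl⟩

theorem coeff_mul_mem_one_of_map_eq_mul {p : D[X]} {h : K[X]}
    (hp : p.map (algebraMap D K) = f.map (algebraMap D K) * h) (n : ℕ) {a : K}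
    (ha : a ∈ (f.contentIdeal : FractionalIdeal D⁰ K)) :
    h.coeff n * a ∈ (1 : FractionalIdeal D⁰ K) := by
  refine mul_mem_one_of_mem_contentIdeal (fun m => ?_) ha
  rw [mul_comm, mem_one_iff_mem_range, ← coeff_map]
  refine coeff_mul_coeff_mem_range (fun k => ?_) m n
  rw [← hp, coeff_map]
  exact ⟨_, rfl⟩

omit [IsDomain D] [IsIntegrallyClosed D] in
theorem fractionalContent_ne_zero (hf : f ≠ 0) :
    (f.contentIdeal : FractionalIdeal D⁰ K) ≠ 0 := by
  rwa [Ne, FractionalIdeal.coeIdeal_eq_zero, contentIdeal_eq_bot_iff]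

omit [IsDomain D] [IsIntegrallyClosed D] in
theorem fractionEmbedding_mul_mem {h : K[X]}
    (hP : ∀ p : D[X], p ∈ P ↔ f.map (algebraMap D K) ∣ p.map (algebraMap D K))
    (hh : ∀ n, ∀ a ∈ (f.contentIdeal : FractionalIdeal D⁰ K),
      h.coeff n * a ∈ (1 : FractionalIdeal D⁰ K)) :
    fractionEmbedding D K L (f.map (algebraMap D K) * h) ∈ (P : FractionalIdeal D[X]⁰ L) := by
  have : ∀ n, (f.map (algebraMap D K) * h).coeff n ∈ (1 : FractionalIdeal D⁰ K) := by
    intro n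
    rw [coeff_mul]
    refine Submodule.sum_mem (1 : FractionalIdeal D⁰ K).val fun ij _ => ?_
    rw [mul_comm, coeff_map]
    refine hh _ _ ((FractionalIdeal.mem_coeIdeal D⁰).2 ⟨_, f.coeff_mem_contentIdeal _, rfl⟩)
  obtain ⟨p, hp⟩ := exists_map_eq_iff.2 this
  rw [← hp, fractionEmbedding_map]
  exact (FractionalIdeal.mem_coeIdeal _).2 ⟨p, (hP p).2 ⟨h, hp⟩, rfl⟩

theorem isTInvertible_of_contentIdeal (hf : f ≠ 0)
    (hP : ∀ p : D[X], p ∈ P ↔ f.map (algebraMap D K) ∣ p.map (algebraMap D K))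
    (h : IsTInvertible (f.contentIdeal : FractionalIdeal D⁰ K)) :
    IsTInvertible (P : FractionalIdeal D[X]⁰ L) := by
  classical
  set I := (f.contentIdeal : FractionalIdeal D⁰ K)
  set φ := fractionEmbedding D K L
  have hφ : Function.Injective φ := fractionEmbedding_injective D K L
  obtain ⟨s, ⟨z₀, hz₀, hz₀0⟩, hs, hsx⟩ := h.exists_finset
  have hfP : f ∈ P := (hP f).2 dvd_rfl
  have hP0 : (P : FractionalIdeal D[X]⁰ L) ≠ 0 := by
    rw [Ne, FractionalIdeal.coeIdeal_eq_zero]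
    rintro rfl
    exact hf hfP
  have hF0 : φ (f.map (algebraMap D K)) ≠ 0 := by
    rw [Ne, map_eq_zero_iff φ hφ, Polynomial.map_eq_zero_iff (IsFractionRing.injective D K)]
    exact hf
  refine isTInvertible_of_finset hP0 (P : FractionalIdeal D[X]⁰ L)⁻¹ (mul_inv_le_one _)
    (s.image fun z => φ (C z)) ?_ ?_
  · intro y hy
    obtain ⟨z, hz, rfl⟩ := Finset.mem_image.1 hy
    refine FractionalIdeal.mul_induction_on (hs z hz) (fun a ha b hb => ?_) (fun x y hx hy => ?_)
    · have e : φ (C (a * b)) = φ (f.map (algebraMap D K) * C b) *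
          (φ (C a) / φ (f.map (algebraMap D K))) := by
        rw [C_mul, map_mul φ, map_mul φ]
        field_simp
      rw [e]
      refine FractionalIdeal.mul_mem_mul (fractionEmbedding_mul_mem hP fun n c hc => ?_) ?_
      · rw [coeff_C]
        split_ifs
        · exact (FractionalIdeal.mem_inv_iff h.1).1 hb c hc
        · rw [zero_mul]
          exact (1 : FractionalIdeal D⁰ K).zero_mem
      · rw [FractionalIdeal.mem_inv_iff hP0]
        intro y hy
        obtain ⟨p, hp, rfl⟩ := (FractionalIdeal.mem_coeIdeal _).1 hy
        obtain ⟨q, hq⟩ := (hP p).1 hp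
        have e' : φ (C a) / φ (f.map (algebraMap D K)) * algebraMap D[X] L p = φ (C a * q) := by
          rw [← fractionEmbedding_map K, hq, map_mul φ, map_mul]
          change φ (C a) / _ * (φ _ * φ q) = _
          field_simp
        rw [e', fractionEmbedding_mem_one_iff]
        intro n
        rw [coeff_C_mul, mul_comm]
        exact coeff_mul_mem_one_of_map_eq_mul hq n ha
    · rw [C_add, map_add]
      exact Submodule.add_mem (FractionalIdeal.coeToSubmodule _) hx hy
  · intro x hx
    have hmem : ∀ z ∈ s, x * φ (C z) ∈ (1 : FractionalIdeal D[X]⁰ L) := fun z hz =>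
      hx _ (Finset.mem_image_of_mem _ hz)
    -- One nonzero `z₀` already forces `x` into `K[X]`, so the condition can then be tested on
    -- coefficients.
    obtain ⟨p, hp⟩ := (FractionalIdeal.mem_one_iff _).1 (hmem z₀ hz₀)
    obtain ⟨q, rfl⟩ : ∃ q : K[X], φ q = x := by
      refine ⟨C z₀⁻¹ * p.map (algebraMap D K), ?_⟩
      rw [map_mul, fractionEmbedding_map, hp, mul_comm, mul_assoc, ← map_mul, ← C_mul,
        mul_inv_cancel₀ hz₀0, C_1, map_one, mul_one]
    rw [fractionEmbedding_mem_one_iff]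
    intro n
    refine hsx _ fun z hz => ?_
    have := hmem z hz
    rw [← map_mul, fractionEmbedding_mem_one_iff] at this
    simpa using this n

theorem isTInvertible_contentIdeal (hf : f ≠ 0)
    (hP : ∀ p : D[X], p ∈ P ↔ f.map (algebraMap D K) ∣ p.map (algebraMap D K))
    (h : IsTInvertible (P : FractionalIdeal D[X]⁰ L)) :
    IsTInvertible (f.contentIdeal : FractionalIdeal D⁰ K) := by
  classical
  have hI0 := fractionalContent_ne_zero (K := K) hf
  set I := (f.contentIdeal : FractionalIdeal D⁰ K) with hI
  set φ := fractionEmbedding D K L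
  obtain ⟨s, -, hs, hsx⟩ := h.exists_finset
  -- For a term `p b` of `z`, with `p = f q ∈ P` and `b ∈ P⁻¹`, take `W` to be the coefficients of
  -- `q`. If `x W c(f) ⊆ D`, then `x p = f (x q)` is again in `P`, whence `x p b ∈ D[X]`.
  have key : ∀ z ∈ (P : FractionalIdeal D[X]⁰ L) * (P : FractionalIdeal D[X]⁰ L)⁻¹,
      ∃ W : Finset K, (∀ w ∈ W, w ∈ I⁻¹) ∧
        ∀ x : K, (∀ w ∈ W, ∀ a ∈ I, x * w * a ∈ (1 : FractionalIdeal D⁰ K)) →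
          φ (C x) * z ∈ (1 : FractionalIdeal D[X]⁰ L) := by
    intro z hz
    refine FractionalIdeal.mul_induction_on hz (fun y hy b hb => ?_) (fun y y' hy hy' => ?_)
    · obtain ⟨p, hp, rfl⟩ := (FractionalIdeal.mem_coeIdeal _).1 hy
      obtain ⟨q, hq⟩ := (hP p).1 hp
      refine ⟨q.coeffs, fun w hw => ?_, fun x hx => ?_⟩
      · obtain ⟨n, -, rfl⟩ := mem_coeffs_iff.1 hw
        rw [FractionalIdeal.mem_inv_iff hI0]
        exact fun a ha => coeff_mul_mem_one_of_map_eq_mul hq n ha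
      · have hmem : φ (f.map (algebraMap D K) * (C x * q)) ∈ (P : FractionalIdeal D[X]⁰ L) := by
          refine fractionEmbedding_mul_mem hP fun n a ha => ?_
          rw [coeff_C_mul]
          by_cases hn : q.coeff n = 0
          · rw [hn, mul_zero, zero_mul]
            exact (1 : FractionalIdeal D⁰ K).zero_mem
          · exact hx _ (coeff_mem_coeffs hn) a ha
        have := (FractionalIdeal.mem_inv_iff h.1).1 hb _ hmem
        rwa [mul_left_comm, ← hq, map_mul, fractionEmbedding_map, mul_comm, mul_assoc] at this
    · obtain ⟨W, hW, hWx⟩ := hy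
      obtain ⟨W', hW', hWx'⟩ := hy'
      refine ⟨W ∪ W', fun w hw => ?_, fun x hx => ?_⟩
      · rcases Finset.mem_union.1 hw with hw | hw
        · exact hW w hw
        · exact hW' w hw
      · rw [mul_add]
        exact (1 : FractionalIdeal D[X]⁰ L).val.add_mem
          (hWx x fun w hw => hx w (Finset.mem_union_left _ hw))
          (hWx' x fun w hw => hx w (Finset.mem_union_right _ hw))
  choose! W hW hWx using key
  refine isTInvertible_of_finset hI0 I⁻¹ (mul_inv_le_one _)
    (Finset.image₂ (fun w c => w * algebraMap D K c) (s.biUnion W) f.coeffs) ?_ ?_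
  · intro y hy
    obtain ⟨w, hw, c, hc, rfl⟩ := Finset.mem_image₂.1 hy
    obtain ⟨z, hz, hw⟩ := Finset.mem_biUnion.1 hw
    obtain ⟨n, -, rfl⟩ := mem_coeffs_iff.1 hc
    rw [mul_comm w]
    exact FractionalIdeal.mul_mem_mul
      ((FractionalIdeal.mem_coeIdeal _).2 ⟨_, f.coeff_mem_contentIdeal _, rfl⟩)
      (hW z (hs z hz) w hw)
  · intro x hx
    rw [← fractionEmbedding_C_mem_one_iff (D := D) L]
    refine hsx _ fun z hz => hWx z (hs z hz) x fun w hw a ha => ?_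
    refine mul_mem_one_of_mem_contentIdeal (fun n => ?_) ha
    by_cases hn : f.coeff n = 0
    · rw [hn, map_zero, mul_zero]
      exact (1 : FractionalIdeal D⁰ K).zero_mem
    · rw [mul_assoc]
      exact hx _ (Finset.mem_image₂_of_mem (Finset.mem_biUnion.2 ⟨z, hz, hw⟩)
        (coeff_mem_coeffs hn))

end Content

/-! ### Structure and existence of primes upper to zero -/

section UpperToZero

variable {D : Type*} [CommRing D]

theorem IsPrimeUpperToZero.eq_zero_of_C_mem {P : Ideal D[X]} (hP : IsPrimeUpperToZero P) {c : D}
    (hc : C c ∈ P) : c = 0 := by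
  have : c ∈ P.comap (C : D →+* D[X]) := hc
  rwa [hP.comap_C_eq_bot] at this

theorem IsPrimeUpperToZero.exists_min_degree {P : Ideal D[X]} (hP : IsPrimeUpperToZero P) :
    ∃ f ∈ P, f ≠ 0 ∧ ∀ g ∈ P, g.degree < f.degree → g = 0 := by
  obtain ⟨f₀, hf₀, h0⟩ := Submodule.exists_mem_ne_zero_of_ne_bot hP.ne_bot
  obtain ⟨f, ⟨hf, hf0⟩, hmin⟩ := (degree_lt_wf (R := D)).has_min {f | f ∈ P ∧ f ≠ 0}
    ⟨f₀, hf₀, h0⟩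
  refine ⟨f, hf, hf0, fun g hg hlt => ?_⟩
  by_contra hg0
  exact hmin g ⟨hg, hg0⟩ hlt

variable [IsDomain D] {K : Type*} [Field K] [Algebra D K] [IsFractionRing D K]

theorem IsPrimeUpperToZero.mem_iff_dvd {P : Ideal D[X]} (hP : IsPrimeUpperToZero P) {f : D[X]}
    (hf : f ∈ P) (hf0 : f ≠ 0) (hmin : ∀ g ∈ P, g.degree < f.degree → g = 0) (p : D[X]) :
    p ∈ P ↔ f.map (algebraMap D K) ∣ p.map (algebraMap D K) := by
  have hinj := IsFractionRing.injective D K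
  constructor
  · intro hp
    set F := f.map (algebraMap D K)
    have hF0 : F ≠ 0 := (Polynomial.map_ne_zero_iff hinj).2 hf0
    obtain ⟨c, hc, q, hq⟩ := exists_C_mul_eq_map (D := D) K (p.map (algebraMap D K) / F)
    -- Division with remainder in `K[X]`, cleared of the denominators of the quotient: `c` times the
    -- remainder lies in `P` and has degree below that of `f`.
    have hmap : (C c * p - f * q).map (algebraMap D K) =
        C (algebraMap D K c) * (p.map (algebraMap D K) % F) := by
      have := EuclideanDomain.div_add_mod (p.map (algebraMap D K)) F
      rw [Polynomial.map_sub, Polynomial.map_mul, Polynomial.map_mul, map_C, ← hq]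
      change _ - F * _ = _
      linear_combination C (algebraMap D K c) * this.symm
    have hzero : C c * p - f * q = 0 := by
      refine hmin _ (P.sub_mem (P.mul_mem_left _ hp) (P.mul_mem_right _ hf)) ?_
      rw [← degree_map_eq_of_injective hinj (C c * p - f * q), hmap,
        degree_C_mul (by simpa using hc), ← degree_map_eq_of_injective hinj f]
      exact EuclideanDomain.mod_lt _ hF0
    rw [hzero, Polynomial.map_zero, eq_comm, mul_eq_zero, C_eq_zero] at hmap
    exact EuclideanDomain.mod_eq_zero.1 (hmap.resolve_left (by simpa using hc))
  · rintro ⟨h, hh⟩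
    obtain ⟨c, hc, q, hq⟩ := exists_C_mul_eq_map (D := D) K h
    have : C c * p = f * q := by
      apply map_algebraMap_injective D K
      rw [Polynomial.map_mul, Polynomial.map_mul, map_C, hh, ← hq]
      ring
    have hmem : C c * p ∈ P := this ▸ P.mul_mem_right _ hf
    exact (hP.isPrime.mem_or_mem hmem).resolve_left fun h => hc (hP.eq_zero_of_C_mem h)

/-- A nonzero ideal meeting `D` in zero avoids the multiplicative set of nonzero constants, and so
does some prime above it. For `A = 0`, start from `(X)` instead. -/
theorem exists_le_isPrimeUpperToZero (A : Ideal D[X])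
    (hA : A.comap (C : D →+* D[X]) = ⊥) : ∃ P, IsPrimeUpperToZero P ∧ A ≤ P := by
  have H : ∀ B : Ideal D[X], B ≠ ⊥ → B.comap (C : D →+* D[X]) = ⊥ →
      ∃ P, IsPrimeUpperToZero P ∧ B ≤ P := by
    intro B hB0 hB
    have hdisj : Disjoint (B : Set D[X]) ((D⁰).map (C : D →+* D[X])) := by
      rw [Set.disjoint_left]
      rintro _ hx ⟨c, hc, rfl⟩
      have : c ∈ B.comap (C : D →+* D[X]) := hx
      rw [hB] at this
      exact nonZeroDivisors.ne_zero hc this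
    obtain ⟨P, hP, hBP, hPd⟩ := Ideal.exists_le_prime_disjoint B _ hdisj
    refine ⟨P, ⟨hP, fun h => hB0 (le_bot_iff.1 (h ▸ hBP)), ?_⟩, hBP⟩
    rw [eq_bot_iff]
    intro c hc
    by_contra hc0
    exact Set.disjoint_left.1 hPd hc ⟨c, mem_nonZeroDivisors_of_ne_zero hc0, rfl⟩
  by_cases hA0 : A = ⊥
  · obtain ⟨P, hP, -⟩ := H (Ideal.span {X}) (by simp) (by
      rw [eq_bot_iff]
      intro c hc
      rw [Ideal.mem_comap, Ideal.mem_span_singleton, X_dvd_iff, coeff_C_zero] at hc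
      exact hc)
    exact ⟨P, hP, hA0 ▸ bot_le⟩
  · exact H A hA0 hA

end UpperToZero

theorem contentIdeal_C_mul_X_add_C {D : Type*} [CommRing D] (a b : D) :
    (C a * X + C b).contentIdeal = Ideal.span {a, b} := by
  apply le_antisymm
  · rw [contentIdeal_def, Ideal.span_le]
    intro c hc
    obtain ⟨n, -, rfl⟩ := mem_coeffs_iff.1 hc
    rcases n with _ | _ | n
    · simpa using Ideal.subset_span (by simp)
    · simpa using Ideal.subset_span (by simp)
    · simp
  · rw [Ideal.span_le]
    rintro c (rfl | rfl) <;> rw [SetLike.mem_coe]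
    · have := (C c * X + C b).coeff_mem_contentIdeal 1
      simpa only [coeff_add, coeff_C_mul, coeff_X_one, coeff_C_succ, mul_one, add_zero] using this
    · have := (C a * X + C c).coeff_mem_contentIdeal 0
      simpa only [coeff_add, coeff_C_mul, coeff_X_zero, coeff_C_zero, mul_zero, zero_add] using this

end TIdeal

theorem proposition3 (D : Type*) [CommRing D] [IsDomain D] [IsIntegrallyClosed D] :
    List.TFAE [
      TIdeal.IsPVMD D,
      ∀ f : D[X], f.natDegree = 1 →
        ∃ P : Ideal D[X], TIdeal.IsPrimeUpperToZero P ∧ TIdeal.IsTInvertibleIdeal P ∧ f ∈ P,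
      ∀ A : Ideal D[X], A.comap (Polynomial.C : D →+* D[X]) = ⊥ →
        ∃ P : Ideal D[X], TIdeal.IsPrimeUpperToZero P ∧ TIdeal.IsTInvertibleIdeal P ∧ A ≤ P] := by
  tfae_have 1 → 3 := by
    intro hD A hA
    obtain ⟨P, hP, hAP⟩ := TIdeal.exists_le_isPrimeUpperToZero A hA
    obtain ⟨f, hf, hf0, hmin⟩ := hP.exists_min_degree
    refine ⟨P, hP, ?_, hAP⟩
    refine TIdeal.isTInvertible_of_contentIdeal (K := FractionRing D) hf0
      (hP.mem_iff_dvd hf hf0 hmin) (hD _ ?_ f.contentIdeal_FG)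
    rwa [Ne, Polynomial.contentIdeal_eq_bot_iff]
  tfae_have 3 → 2 := by
    intro h f hf
    obtain ⟨P, hP, hPt, hfP⟩ := h (Ideal.span {f}) (by
      rw [eq_bot_iff]
      intro c hc
      rw [Ideal.mem_comap, Ideal.mem_span_singleton] at hc
      by_contra hc0
      have := Polynomial.natDegree_le_of_dvd hc (Polynomial.C_ne_zero.2 hc0)
      rw [hf, Polynomial.natDegree_C] at this
      omega)
    exact ⟨P, hP, hPt, hfP (Ideal.mem_span_singleton_self f)⟩
  tfae_have 2 → 1 := by
    intro h
    refine TIdeal.isPVMD_of_span_pair fun a b ha => ?_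
    obtain ⟨P, hP, hPt, hf⟩ := h _ (Polynomial.natDegree_linear (b := b) ha)
    have hf0 : Polynomial.C a * Polynomial.X + Polynomial.C b ≠ 0 := fun h0 => by
      have := Polynomial.natDegree_linear (b := b) ha
      rw [h0, Polynomial.natDegree_zero] at this
      omega
    -- An element of `P` of smaller degree is constant, hence zero because `P ∩ D = 0`.
    have hmin : ∀ g ∈ P,
        g.degree < (Polynomial.C a * Polynomial.X + Polynomial.C b).degree → g = 0 := by
      intro g hg hlt
      rw [Polynomial.degree_linear ha] at hlt
      have hgC := Polynomial.eq_C_of_degree_le_zero (Nat.WithBot.lt_one_iff_le_zero.1 hlt)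
      rw [hgC] at hg ⊢
      rw [hP.eq_zero_of_C_mem hg, Polynomial.C_0]
    rw [← TIdeal.contentIdeal_C_mul_X_add_C]
    exact TIdeal.isTInvertible_contentIdeal hf0 (hP.mem_iff_dvd hf hf0 hmin) hPt
  tfae_finish
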